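/- **Setting.** Let $(\Omega,F,\mathbf P)$ be a probability space, $d\ge 1$ an integer, $n\in\{1,2,\dots\}\cup\{\infty\}$, $p\ge 2$ a real number, and let $\xi(i,m)$ ($1\le i\le n$, $i<\infty$, $1\le m\le d$) be real random variables, all of them jointly independent and centered, $\mathbf E\,\xi(i,m)=0$. Write $|\eta|_p=(\mathbf E|\eta|^p)^{1/p}$, $\mu_m(p)=\sup_i|\xi(i,m)|_p$, and assume $\mu_m(p)<\infty$ for $m=1,\dots,d$. Let $I(d,n)$ be the set of integer vectors $i=(i_1,\dots,i_d)$ with $1\le i_1<i_2<\dots<i_d\le n$ (and all $i_s<\infty$). For real coefficients $b=(b(i))_{i\in I(d,n)}$ with $\|b\|^2=\sum_{i\in I(d,n)}b(i)^2<\infty$ put $$Q(d,n,b)=\sum_{i\in I(d,n)}b(i)\prod_{s=1}^d\xi(i_s,s)$$ if $n<\infty$, and let $Q(d,\infty,b)=\lim_{N\to\infty}Q(d,N,b)$ whenever this limit exists with probability one. **Constants.** Let $K_R$ be Rosenthal's constant, i.e. the least $C\ge 0$ such that $$\Big|\sum_{k=1}^N\eta_k\Big|_q\le C\,\frac{q}{\ln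 q}\,\max\Big\{\Big|\sum_{k=1}^N\eta_k\Big|_2,\ \Big(\sum_{k=1}^N|\eta_k|_q^q\Big)^{1/q}\Big\}$$ for all $q\ge 2$, all $N$ and all independent centered random variables $\eta_1,\dots,\eta_N$ with finite $q$-th moments. Let $$Os(q)=4\sqrt2\,\Big(\frac q4+1\Big)^{1/q}\Big(1+\frac{q}{\ln(q/2)}\Big),\qquad K_{Os}=\sup_{q\ge 4}\frac{Os(q)}{q/\ln q},$$ and define $\kappa(1)=K_R$ and $\kappa(d+1)=\kappa(d)\,K_{Os}\,(1+1/d)^d$ for $d\ge1$. **Theorem 3.1.** Under these assumptions $$\sup_{\|b\|=1}|Q(d,n,b)|_p\ \le\ \kappa(d)\,\Big(\frac{p}{\ln p}\Big)^d\,\prod_{m=1}^d\mu_m(p),$$ where for $n=\infty$ the supremum is over those $b$ with $\|b\|=1$ for which $Q(d,\infty,b)$ exists. -/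

import Mathlib

open MeasureTheory ProbabilityTheory Filter Topology
open scoped ENNReal

/-- The index set `I(d, n)` of all tuples `1 ≤ i₁ < i₂ < ⋯ < i_d ≤ n` of integers, `n ≤ ∞`. -/
def indexSet (d : ℕ) (n : ℕ∞) : Set (Fin d → ℕ) :=
  {i | StrictMono i ∧ ∀ s, 1 ≤ i s ∧ (i s : ℕ∞) ≤ n}

theorem indexSet_finite (d N : ℕ) : (indexSet d (N : ℕ∞)).Finite := by
  refine (Set.Finite.pi' (fun _ : Fin d => Set.finite_Icc 1 N)).subset ?_
  intro i hi s
  exact ⟨(hi.2 s).1, by exact_mod_cast (hi.2 s).2⟩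

/-- The random polynomial `Q(d, N, b) = ∑ b(i) ξ(i₁, 1) ξ(i₂, 2) ⋯ ξ(i_d, d)`, the sum being over
all `i ∈ I(d, N)`, for a finite `N`. -/
noncomputable def randomPolynomial {Ω : Type*} {d : ℕ} (ξ : ℕ → Fin d → Ω → ℝ)
    (b : (Fin d → ℕ) → ℝ) (N : ℕ) (ω : Ω) : ℝ :=
  ∑ i ∈ (indexSet_finite d N).toFinset, b i * ∏ s, ξ (i s) s ω

/-- `Q` is (a version of) the random polynomial `Q(d, n, b)`, `n ≤ ∞`. For `n = ∞` this means that
the finite polynomials `Q(d, N, b)` converge to `Q` with probability one as `N → ∞`. -/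
def IsRandomPolynomial {Ω : Type*} [MeasurableSpace Ω] (P : Measure Ω) {d : ℕ} (n : ℕ∞)
    (ξ : ℕ → Fin d → Ω → ℝ) (b : (Fin d → ℕ) → ℝ) (Q : Ω → ℝ) : Prop :=
  (∀ N : ℕ, n = N → ∀ᵐ ω ∂P, Q ω = randomPolynomial ξ b N ω) ∧
  (n = ⊤ → ∀ᵐ ω ∂P, Tendsto (fun N : ℕ => randomPolynomial ξ b N ω) atTop (𝓝 (Q ω)))

/-- `U(p; d, n)`: the supremum of `|Q(d, n, b)|_p` over all real coefficients `b` on `I(d, n)` with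
`‖b‖² = ∑ b(i)² = 1` (for `n = ∞`, over those for which `Q(d, ∞, b)` exists). -/
noncomputable def polynomialMomentSup {Ω : Type*} [MeasurableSpace Ω] (P : Measure Ω) {d : ℕ}
    (n : ℕ∞) (ξ : ℕ → Fin d → Ω → ℝ) (p : ℝ) : ℝ≥0∞ :=
  ⨆ (b : (Fin d → ℕ) → ℝ) (_ : HasSum (fun i : indexSet d n => b i ^ 2) 1)
    (Q : Ω → ℝ) (_ : IsRandomPolynomial P n ξ b Q), eLpNorm Q (ENNReal.ofReal p) P

/-- `μ_m(p) = sup_i |ξ(i, m)|_p`, the supremum being over `1 ≤ i ≤ n`, `i < ∞`. -/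
noncomputable def momentMax {Ω : Type*} [MeasurableSpace Ω] (P : Measure Ω) {d : ℕ}
    (n : ℕ∞) (ξ : ℕ → Fin d → Ω → ℝ) (m : Fin d) (p : ℝ) : ℝ≥0∞ :=
  ⨆ (i : ℕ) (_ : 1 ≤ i ∧ (i : ℕ∞) ≤ n), eLpNorm (ξ i m) (ENNReal.ofReal p) P

/-- The function `Os(p) = 4 √2 (p/4 + 1)^{1/p} (1 + p / ln (p/2))`. -/
noncomputable def osekowskiFunction (p : ℝ) : ℝ :=
  4 * √2 * (p / 4 + 1) ^ (1 / p) * (1 + p / Real.log (p / 2))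

/-- Osekowski's constant `K_Os = sup_{p ≥ 4} Os(p) / (p / ln p)` (finite, about `15.7858`). -/
noncomputable def osekowskiConstant : ℝ :=
  sSup ((fun p : ℝ => osekowskiFunction p / (p / Real.log p)) '' Set.Ici 4)

/-- `C` is admissible in Rosenthal's inequality: for all `p ≥ 2` and all finite families of
independent centered random variables with finite `p`-th moments,
`|∑ ηₖ|_p ≤ C (p / ln p) max (|∑ ηₖ|₂, (∑ |ηₖ|_p^p)^{1/p})`. -/
def IsRosenthalBound (C : ℝ) : Prop :=
  0 ≤ C ∧ ∀ (p : ℝ), 2 ≤ p → ∀ (Ω : Type) (_ : MeasurableSpace Ω) (P : Measure Ω),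
    IsProbabilityMeasure P → ∀ (n : ℕ) (η : Fin n → Ω → ℝ),
    (∀ k, MemLp (η k) (ENNReal.ofReal p) P) → (∀ k, ∫ ω, η k ω ∂P = 0) → iIndepFun η P →
    eLpNorm (fun ω => ∑ k, η k ω) (ENNReal.ofReal p) P ≤
      ENNReal.ofReal (C * (p / Real.log p)) *
        max (eLpNorm (fun ω => ∑ k, η k ω) 2 P)
          ((∑ k, eLpNorm (η k) (ENNReal.ofReal p) P ^ p) ^ (1 / p))

/-- Rosenthal's constant `K_R`: the best constant in Rosenthal's inequality. -/
noncomputable def rosenthalConstant : ℝ := sInf {C : ℝ | IsRosenthalBound C}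

/-- `κ(1) = K_R` and `κ(d + 1) = κ(d) K_Os (1 + 1/d)^d` for `d ≥ 1`. The value at `0` is not used. -/
noncomputable def kappa : ℕ → ℝ
  | 0 => 0
  | 1 => rosenthalConstant
  | d + 2 => kappa (d + 1) * osekowskiConstant * (1 + 1 / ((d + 1 : ℕ) : ℝ)) ^ (d + 1)

/-!
The random variables with different second index are independent, so no martingale inequality is
needed: given all `ξ(·, m)` but one, say `ξ(·, 1)`, the polynomial is a linear form
`∑ₖ Aₖ ξ(k, 1)` in independent centered variables, with coefficients `Aₖ` that do not involve
`ξ(·, 1)`. Rosenthal's inequality, applied conditionally, and the fact that the `ℓᵖ` norm is at most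
the `ℓ²` norm bound its conditional `p`-norm by `K_R (p / ln p) μ₁(p) (∑ₖ Aₖ²)^{1/2}`
(`eLpNorm_linear_le`). By Minkowski's inequality in `L^{p/2}` the `p`-norm of `(∑ₖ Aₖ²)^{1/2}` is at
most `(∑ₖ |Aₖ|_p²)^{1/2}`, and each `Aₖ` is a polynomial of degree `d - 1`. Induction on `d`
(`eLpNorm_multilinear_le`) gives the bound with the constant `K_R ^ d` for finite `n`, and Fatou's
lemma extends it to `n = ∞`.

It remains to compare `K_R ^ d` with `κ(d)`, that is, to see that `K_R ≤ K_Os`. Evaluating the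
function at `p = 4` gives `K_Os ≥ 8`. An upper bound for `K_R`, and already its being the infimum of
a nonempty set, requires a proof of Rosenthal's inequality with the rate `p / ln p`; the constant `3`
is obtained in `rosenthal_inequality` as follows. Let `y` be slightly larger than the maximum on the
right-hand side and truncate all variables at level `y`. For the sum of the truncated variables,
`E exp (t S) ≤ exp (e ^ (t y) - 1)`, and the choice `t = ln p / y` gives `|S|_p ≤ (p / ln p) y`. For
the remainders, the number of nonzero ones is a sum of independent Bernoulli variables of total
mean at most `1`, whose exponential moment at `ln p` is again at most `e ^ (p - 1)`; the power mean
inequality then bounds the `p`-norm of their sum by `2 (p / ln p) y`.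
-/

/-! ### Truncation and exponential bounds -/

/-- Monotonicity of `(exp u - 1 - u) / u ^ 2`, the inequality behind Bennett's bound, in a form
without division. -/
theorem sq_mul_exp_sub_one_sub_le {u v : ℝ} (h : |u| ≤ v) :
    v ^ 2 * (Real.exp u - 1 - u) ≤ u ^ 2 * (Real.exp v - 1 - v) := by
  have key : ∀ w : ℝ, HasSum (fun n : ℕ => w ^ (n + 2) / (n + 2).factorial)
      (Real.exp w - 1 - w) := by
    intro w
    have h0 : HasSum (fun n : ℕ => w ^ n / n.factorial) (Real.exp w) := by
      rw [Real.exp_eq_exp_ℝ]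
      exact NormedSpace.expSeries_div_hasSum_exp w
    have h1 := (hasSum_nat_add_iff' 2).2 h0
    have h2 : Real.exp w - 1 - w
        = Real.exp w - ∑ i ∈ Finset.range 2, w ^ i / i.factorial := by
      simp [Finset.sum_range_succ]
      ring
    rw [h2]
    exact h1
  refine hasSum_le (fun n => ?_) ((key u).mul_left (v ^ 2)) ((key v).mul_left (u ^ 2))
  have h3 : u ^ n ≤ v ^ n := (le_abs_self _).trans (by rw [abs_pow]; gcongr)
  calc v ^ 2 * (u ^ (n + 2) / (n + 2).factorial)
      = u ^ n * (u ^ 2 * v ^ 2 / (n + 2).factorial) := by ring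
    _ ≤ v ^ n * (u ^ 2 * v ^ 2 / (n + 2).factorial) := by gcongr
    _ = u ^ 2 * (v ^ (n + 2) / (n + 2).factorial) := by ring

/-- The truncation `x 1_{|x| ≤ y}` of a real number `x` at level `y`. -/
noncomputable def truncate (y x : ℝ) : ℝ := if |x| ≤ y then x else 0

theorem measurable_truncate (y : ℝ) : Measurable (truncate y) := by
  unfold truncate
  exact Measurable.ite (measurableSet_le (by fun_prop) measurable_const) measurable_id
    measurable_const

theorem truncate_neg (y x : ℝ) : truncate y (-x) = -truncate y x := by
  unfold truncate
  rw [abs_neg]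
  split_ifs <;> simp

/-- The right-hand side is linear in `x` and `x ^ 2` of the untruncated `x`, so it can be integrated
using `E x = 0`; the mean of the truncated variable never enters. -/
theorem exp_mul_truncate_le {y lam : ℝ} (hy : 0 < y) (hl : 0 < lam) (x : ℝ) :
    Real.exp (lam * truncate y x) ≤ 1 + lam * x + x ^ 2 / y ^ 2 * (Real.exp (lam * y) - 1) := by
  have hexp := Real.add_one_le_exp (lam * y)
  unfold truncate
  split_ifs with h
  · have h1 : |lam * x| ≤ lam * y := by rw [abs_mul, abs_of_pos hl]; gcongr
    have h2 := sq_mul_exp_sub_one_sub_le h1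
    have h3 : Real.exp (lam * x) - 1 - lam * x
        ≤ x ^ 2 / y ^ 2 * (Real.exp (lam * y) - 1 - lam * y) := by
      rw [div_mul_eq_mul_div, le_div_iff₀ (by positivity)]
      have h4 : 0 < lam ^ 2 := by positivity
      nlinarith
    have h5 : 0 ≤ x ^ 2 / y ^ 2 * (lam * y) := by positivity
    linarith
  · push Not at h
    have h1 : |x| ≤ x ^ 2 / y := by
      rw [le_div_iff₀ hy, ← sq_abs, sq]
      gcongr
    have h2 : lam * |x| ≤ x ^ 2 / y ^ 2 * (lam * y) := by
      calc lam * |x| ≤ lam * (x ^ 2 / y) := by gcongr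
        _ = _ := by field_simp
    have h3 : x ^ 2 / y ^ 2 * (lam * y) ≤ x ^ 2 / y ^ 2 * (Real.exp (lam * y) - 1) := by
      gcongr; linarith
    have h4 : -(lam * |x|) ≤ lam * x := by
      rw [← mul_neg]; gcongr; exact neg_abs_le x
    simp only [mul_zero, Real.exp_zero]
    linarith

/-- The maximum of `s ^ p * exp (-lam * s)` is attained at `s = p / lam`. -/
theorem rpow_le_exp_mul {p lam s : ℝ} (hp : 0 < p) (hl : 0 < lam) (hs : 0 ≤ s) :
    s ^ p ≤ (p / lam) ^ p * Real.exp (-p) * Real.exp (lam * s) := by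
  have h1 : lam * s / p ≤ Real.exp (lam * s / p - 1) := by
    have := Real.add_one_le_exp (lam * s / p - 1); linarith
  have h2 : s ≤ p / lam * Real.exp (lam * s / p - 1) := by
    calc s = p / lam * (lam * s / p) := by field_simp
      _ ≤ _ := by gcongr
  calc s ^ p ≤ (p / lam * Real.exp (lam * s / p - 1)) ^ p := by gcongr
    _ = (p / lam) ^ p * Real.exp ((lam * s / p - 1) * p) := by
      rw [Real.mul_rpow (by positivity) (by positivity), ← Real.exp_mul]
    _ = _ := by
      rw [mul_assoc, ← Real.exp_add]
      congr 2
      field_simp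
      ring

/-! ### Moments of truncated sums of independent variables -/

theorem ProbabilityTheory.iIndepFun.lintegral_prod_comp {Ω : Type*} [MeasurableSpace Ω]
    {P : Measure Ω} {n : ℕ} {η : Fin n → Ω → ℝ} (h : iIndepFun η P)
    (hm : ∀ k, AEMeasurable (η k) P) {f : Fin n → ℝ → ℝ≥0∞} (hf : ∀ k, Measurable (f k)) :
    ∫⁻ ω, ∏ k, f k (η k ω) ∂P = ∏ k, ∫⁻ ω, f k (η k ω) ∂P := by
  have h1 : iIndepFun (fun k => f k ∘ (hm k).mk) P :=
    (h.congr fun k => (hm k).ae_eq_mk).comp f hf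
  have h2 := lintegral_prod_eq_prod_lintegral_of_indepFun Finset.univ _ h1
    fun k => (hf k).comp (hm k).measurable_mk
  have h3 : ∀ k, ∫⁻ ω, f k (η k ω) ∂P = ∫⁻ ω, (f k ∘ (hm k).mk) ω ∂P := fun k =>
    lintegral_congr_ae ((hm k).ae_eq_mk.fun_comp (f k))
  have h4 : ∀ᵐ ω ∂P, ∀ k, η k ω = (hm k).mk _ ω := ae_all_iff.2 fun k => (hm k).ae_eq_mk
  simp_rw [h3]
  rw [← h2]
  refine lintegral_congr_ae ?_
  filter_upwards [h4] with ω hω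
  exact Finset.prod_congr rfl fun k _ => by rw [hω k]; rfl

theorem eLpNorm_eq_lintegral_ofReal_abs {Ω : Type*} [MeasurableSpace Ω] {P : Measure Ω}
    {p : ℝ} (hp : 0 < p) (f : Ω → ℝ) :
    eLpNorm f (ENNReal.ofReal p) P = (∫⁻ ω, ENNReal.ofReal (|f ω| ^ p) ∂P) ^ (1 / p) := by
  rw [eLpNorm_eq_lintegral_rpow_enorm_toReal (by simpa using hp) ENNReal.ofReal_ne_top,
    ENNReal.toReal_ofReal hp.le]
  congr 1
  refine lintegral_congr fun ω => ?_
  rw [Real.enorm_eq_ofReal_abs, ENNReal.ofReal_rpow_of_nonneg (abs_nonneg _) hp.le]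

theorem eLpNorm_le_of_lintegral_le {Ω : Type*} [MeasurableSpace Ω] {P : Measure Ω}
    {p a : ℝ} (hp : 0 < p) (ha : 0 ≤ a) {f : Ω → ℝ}
    (h : ∫⁻ ω, ENNReal.ofReal (|f ω| ^ p) ∂P ≤ ENNReal.ofReal (a ^ p)) :
    eLpNorm f (ENNReal.ofReal p) P ≤ ENNReal.ofReal a := by
  rw [eLpNorm_eq_lintegral_ofReal_abs hp]
  refine (ENNReal.rpow_le_rpow h (by positivity)).trans_eq ?_
  rw [ENNReal.ofReal_rpow_of_nonneg (by positivity) (by positivity), ← Real.rpow_mul ha,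
    mul_one_div_cancel hp.ne', Real.rpow_one]

theorem eLpNorm_two_sq {Ω : Type*} [MeasurableSpace Ω] {P : Measure Ω} {f : Ω → ℝ}
    (hf : MemLp f 2 P) : eLpNorm f 2 P ^ 2 = ENNReal.ofReal (∫ ω, f ω ^ 2 ∂P) := by
  have h := eLpNorm_eq_lintegral_ofReal_abs (P := P) (p := 2) (by norm_num) f
  rw [ENNReal.ofReal_ofNat] at h
  rw [ofReal_integral_eq_lintegral_ofReal hf.integrable_sq (ae_of_all _ fun _ => sq_nonneg _), h,
    ← ENNReal.rpow_natCast, ← ENNReal.rpow_mul]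
  norm_num

section Rosenthal

variable {Ω : Type*} [MeasurableSpace Ω] {P : Measure Ω} [IsProbabilityMeasure P] {n : ℕ}
  {η : Fin n → Ω → ℝ} {y : ℝ}

/-- If `0 ≤ g k x ≤ 1 + l x + c (x / y) ^ 2`, then `E g k (η k) ≤ exp (c E (η k) ^ 2 / y ^ 2)`, the
linear term having mean zero; multiplied over any set of indices, these bounds give `exp c`. -/
theorem prod_lintegral_le_exp {g : Fin n → ℝ → ℝ} {l : ℝ} {c : ℝ} (s : Finset (Fin n))
    (hg : ∀ k ∈ s, ∀ x, 0 ≤ g k x) (hgle : ∀ k ∈ s, ∀ x, g k x ≤ 1 + l * x + x ^ 2 / y ^ 2 * c)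
    (hc : 0 ≤ c) (hy : 0 < y) (h2 : ∀ k, MemLp (η k) 2 P) (h0 : ∀ k, ∫ ω, η k ω ∂P = 0)
    (hσ : ∑ k, ∫ ω, η k ω ^ 2 ∂P ≤ y ^ 2) :
    ∏ k ∈ s, ∫⁻ ω, ENNReal.ofReal (g k (η k ω)) ∂P ≤ ENNReal.ofReal (Real.exp c) := by
  have hint : ∀ k, Integrable (η k) P := fun k => (h2 k).integrable (by norm_num)
  have hint2 : ∀ k, Integrable (fun ω => η k ω ^ 2) P := fun k => (h2 k).integrable_sq
  have h1 : ∀ k ∈ s, ∫⁻ ω, ENNReal.ofReal (g k (η k ω)) ∂P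
      ≤ ENNReal.ofReal (Real.exp ((∫ ω, η k ω ^ 2 ∂P) / y ^ 2 * c)) := by
    intro k hk
    have hI : Integrable (fun ω => 1 + l * η k ω + η k ω ^ 2 / y ^ 2 * c) P :=
      ((integrable_const _).add ((hint k).const_mul _)).add (((hint2 k).div_const _).mul_const _)
    calc ∫⁻ ω, ENNReal.ofReal (g k (η k ω)) ∂P
        ≤ ∫⁻ ω, ENNReal.ofReal (1 + l * η k ω + η k ω ^ 2 / y ^ 2 * c) ∂P :=
          lintegral_mono fun ω => ENNReal.ofReal_le_ofReal (hgle k hk _)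
      _ = ENNReal.ofReal (∫ ω, 1 + l * η k ω + η k ω ^ 2 / y ^ 2 * c ∂P) := by
          rw [ofReal_integral_eq_lintegral_ofReal hI]
          exact ae_of_all _ fun ω => (hg k hk _).trans (hgle k hk _)
      _ ≤ _ := by
          refine ENNReal.ofReal_le_ofReal ?_
          have e1 : ∫ ω, 1 + l * η k ω + η k ω ^ 2 / y ^ 2 * c ∂P
              = 1 + (∫ ω, η k ω ^ 2 ∂P) / y ^ 2 * c := by
            have hI1 : Integrable (fun ω => 1 + l * η k ω) P :=
              (integrable_const _).add ((hint k).const_mul _)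
            rw [integral_add hI1 (((hint2 k).div_const _).mul_const _),
              integral_add (integrable_const _) ((hint k).const_mul _), integral_const_mul, h0 k,
              integral_mul_const, integral_div]
            simp
          rw [e1, add_comm]
          exact Real.add_one_le_exp _
  refine (Finset.prod_le_prod' h1).trans ?_
  rw [← ENNReal.ofReal_prod_of_nonneg fun _ _ => (Real.exp_pos _).le, ← Real.exp_sum]
  refine ENNReal.ofReal_le_ofReal (Real.exp_le_exp.2 ?_)
  rw [← Finset.sum_mul, ← Finset.sum_div]
  have h3 : ∑ k ∈ s, ∫ ω, η k ω ^ 2 ∂P ≤ y ^ 2 :=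
    (Finset.sum_le_univ_sum_of_nonneg fun k => integral_nonneg fun ω => sq_nonneg _).trans hσ
  calc (∑ k ∈ s, ∫ ω, η k ω ^ 2 ∂P) / y ^ 2 * c ≤ 1 * c := by
        gcongr; exact (div_le_one (by positivity)).2 h3
    _ = c := one_mul c

theorem lintegral_exp_sum_truncate_le (hind : iIndepFun η P) (h2 : ∀ k, MemLp (η k) 2 P)
    (h0 : ∀ k, ∫ ω, η k ω ∂P = 0) (hy : 0 < y) (hσ : ∑ k, ∫ ω, η k ω ^ 2 ∂P ≤ y ^ 2)
    {lam : ℝ} (hl : 0 < lam) :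
    ∫⁻ ω, ENNReal.ofReal (Real.exp (lam * ∑ k, truncate y (η k ω))) ∂P
      ≤ ENNReal.ofReal (Real.exp (Real.exp (lam * y) - 1)) := by
  have hm : ∀ k, AEMeasurable (η k) P := fun k => (h2 k).aestronglyMeasurable.aemeasurable
  have e : ∀ ω, ENNReal.ofReal (Real.exp (lam * ∑ k, truncate y (η k ω)))
      = ∏ k, ENNReal.ofReal (Real.exp (lam * truncate y (η k ω))) := fun ω => by
    rw [Finset.mul_sum, Real.exp_sum, ENNReal.ofReal_prod_of_nonneg fun _ _ => (Real.exp_pos _).le]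
  simp_rw [e]
  have hmeas : Measurable fun x : ℝ => ENNReal.ofReal (Real.exp (lam * truncate y x)) :=
    ((measurable_truncate y).const_mul lam).exp.ennreal_ofReal
  rw [hind.lintegral_prod_comp hm (f := fun _ x => ENNReal.ofReal (Real.exp (lam * truncate y x)))
    fun _ => hmeas]
  refine prod_lintegral_le_exp (g := fun _ x => Real.exp (lam * truncate y x)) Finset.univ
    (fun _ _ _ => (Real.exp_pos _).le) (fun _ _ x => exp_mul_truncate_le hy hl x) ?_ hy h2 h0 hσ
  have := Real.add_one_le_exp (lam * y)
  have : 0 < lam * y := by positivity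
  linarith

/-- The small parts of the summands contribute at most `(p / ln p) y` to the `p`-norm. -/
theorem lintegral_sum_truncate_rpow_le (hind : iIndepFun η P) (h2 : ∀ k, MemLp (η k) 2 P)
    (h0 : ∀ k, ∫ ω, η k ω ∂P = 0) (hy : 0 < y) (hσ : ∑ k, ∫ ω, η k ω ^ 2 ∂P ≤ y ^ 2)
    {p : ℝ} (hp : 2 ≤ p) :
    ∫⁻ ω, ENNReal.ofReal (|∑ k, truncate y (η k ω)| ^ p) ∂P
      ≤ ENNReal.ofReal ((p / Real.log p * y) ^ p) := by
  have hm : ∀ k, AEMeasurable (η k) P := fun k => (h2 k).aestronglyMeasurable.aemeasurable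
  have hp0 : 0 < p := by linarith
  have hL : 0 < Real.log p := Real.log_pos (by linarith)
  -- With `lam y = log p` the exponential moment is at most `exp (p - 1)`.
  set lam := Real.log p / y with hlam
  have hl : 0 < lam := by positivity
  have hly : Real.exp (lam * y) = p := by
    rw [hlam, div_mul_cancel₀ _ hy.ne', Real.exp_log hp0]
  have hpos := lintegral_exp_sum_truncate_le hind h2 h0 hy hσ hl
  have hneg := lintegral_exp_sum_truncate_le (η := fun k ω => -η k ω)
    (hind.comp (fun _ x => -x) fun _ => measurable_neg) (fun k => (h2 k).neg)
    (fun k => by rw [integral_neg, h0 k, neg_zero]) hy (by simpa using hσ) hl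
  simp only [truncate_neg, Finset.sum_neg_distrib] at hneg
  rw [hly] at hpos hneg
  have hSm : AEMeasurable (fun ω => ∑ k, truncate y (η k ω)) P :=
    Finset.aemeasurable_fun_sum _ fun k _ => (measurable_truncate y).comp_aemeasurable (hm k)
  set C := (p / lam) ^ p * Real.exp (-p) with hC
  have hC0 : 0 ≤ C := by positivity
  have hpt : ∀ s : ℝ, ENNReal.ofReal (|s| ^ p) ≤ ENNReal.ofReal C *
      (ENNReal.ofReal (Real.exp (lam * s)) + ENNReal.ofReal (Real.exp (lam * -s))) := by
    intro s
    rw [← ENNReal.ofReal_add (Real.exp_pos _).le (Real.exp_pos _).le, ← ENNReal.ofReal_mul hC0]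
    refine ENNReal.ofReal_le_ofReal ((rpow_le_exp_mul hp0 hl (abs_nonneg s)).trans ?_)
    gcongr
    rcases abs_cases s with h | h <;> rw [h.1] <;>
      linarith [Real.exp_pos (lam * s), Real.exp_pos (lam * -s)]
  calc ∫⁻ ω, ENNReal.ofReal (|∑ k, truncate y (η k ω)| ^ p) ∂P
      ≤ ∫⁻ ω, ENNReal.ofReal C * (ENNReal.ofReal (Real.exp (lam * ∑ k, truncate y (η k ω)))
        + ENNReal.ofReal (Real.exp (lam * -∑ k, truncate y (η k ω)))) ∂P :=
        lintegral_mono fun ω => hpt _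
    _ = ENNReal.ofReal C * (∫⁻ ω, ENNReal.ofReal (Real.exp (lam * ∑ k, truncate y (η k ω))) ∂P
        + ∫⁻ ω, ENNReal.ofReal (Real.exp (lam * -∑ k, truncate y (η k ω))) ∂P) := by
        rw [lintegral_const_mul' _ _ ENNReal.ofReal_ne_top, lintegral_add_left']
        exact (hSm.const_mul lam).exp.ennreal_ofReal
    _ ≤ ENNReal.ofReal C *
        (ENNReal.ofReal (Real.exp (p - 1)) + ENNReal.ofReal (Real.exp (p - 1))) := by
        gcongr
    _ = ENNReal.ofReal (C * (Real.exp (p - 1) + Real.exp (p - 1))) := by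
        rw [← ENNReal.ofReal_add (Real.exp_pos _).le (Real.exp_pos _).le, ENNReal.ofReal_mul hC0]
    _ ≤ _ := by
        refine ENNReal.ofReal_le_ofReal ?_
        have e1 : Real.exp (-p) * Real.exp (p - 1) = Real.exp (-1) := by
          rw [← Real.exp_add]; congr 1; ring
        have e2 : p / lam = p / Real.log p * y := by rw [hlam]; field_simp
        have e3 : 2 * Real.exp (-1) ≤ 1 := by
          rw [Real.exp_neg, ← div_eq_mul_inv, div_le_one (Real.exp_pos _)]
          have := Real.add_one_le_exp 1; linarith
        rw [hC, e2]
        calc (p / Real.log p * y) ^ p * Real.exp (-p) * (Real.exp (p - 1) + Real.exp (p - 1))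
            = (p / Real.log p * y) ^ p * (2 * (Real.exp (-p) * Real.exp (p - 1))) := by ring
          _ ≤ (p / Real.log p * y) ^ p * 1 := by rw [e1]; gcongr
          _ = _ := mul_one _


/-- With `m` the number of `k` with `|x k| > y`, the power mean inequality gives the factor
`m ^ (p - 1)`, which is then replaced by a multiple of `exp (m * log p) = p ^ m`. This is a product
over the indices, and splitting off the factor of index `k` makes it independent of `x k`. -/
theorem abs_sum_sub_truncate_rpow_le {p : ℝ} (hp : 2 ≤ p) (x : Fin n → ℝ) :
    |∑ k, (x k - truncate y (x k))| ^ p ≤ (p / Real.log p) ^ p * Real.exp (-p) * p *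
      ∑ k, |x k| ^ p * ∏ j ∈ Finset.univ.erase k, (if |x j| ≤ y then 1 else p) := by
  have hp0 : 0 < p := by linarith
  have hL : 0 < Real.log p := Real.log_pos (by linarith)
  set s := Finset.univ.filter fun k => ¬ |x k| ≤ y with hs
  have e1 : ∑ k, (x k - truncate y (x k)) = ∑ k ∈ s, x k := by
    rw [hs, Finset.sum_filter]
    refine Finset.sum_congr rfl fun k _ => ?_
    unfold truncate
    split_ifs <;> simp
  have h1 : |∑ k ∈ s, x k| ^ p ≤ (s.card : ℝ) ^ (p - 1) * ∑ k ∈ s, |x k| ^ p :=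
    (Real.rpow_le_rpow (abs_nonneg _) (Finset.abs_sum_le_sum_abs _ _) hp0.le).trans
      (Real.rpow_sum_le_const_mul_sum_rpow s x (by linarith))
  have hprod0 : ∀ t : Finset (Fin n), 0 ≤ ∏ j ∈ t, (if |x j| ≤ y then 1 else p) := fun t =>
    Finset.prod_nonneg fun j _ => by split_ifs <;> linarith
  have h2 : ∀ k ∈ s, (s.card : ℝ) ^ (p - 1) ≤ (p / Real.log p) ^ p * Real.exp (-p) * p *
      ∏ j ∈ Finset.univ.erase k, (if |x j| ≤ y then 1 else p) := by
    intro k hk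
    have hc : (1 : ℝ) ≤ s.card := by exact_mod_cast Finset.card_pos.2 ⟨k, hk⟩
    have hkp : (if |x k| ≤ y then 1 else p) = p := if_neg (Finset.mem_filter.1 hk).2
    have e2 : Real.exp (Real.log p * s.card)
        = p * ∏ j ∈ Finset.univ.erase k, (if |x j| ≤ y then 1 else p) := by
      conv_rhs => rw [← hkp]
      rw [hkp, ← Real.rpow_def_of_pos hp0, Real.rpow_natCast]
      have := Finset.mul_prod_erase Finset.univ (fun j => if |x j| ≤ y then 1 else p)
        (Finset.mem_univ k)
      simp only [hkp] at this
      rw [this, Finset.prod_ite]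
      simp [hs]
    calc (s.card : ℝ) ^ (p - 1) ≤ (s.card : ℝ) ^ p := by
          exact Real.rpow_le_rpow_of_exponent_le hc (by linarith)
      _ ≤ _ := rpow_le_exp_mul hp0 hL (by positivity)
      _ = _ := by rw [e2]; ring
  rw [e1]
  refine h1.trans ?_
  rw [Finset.mul_sum, Finset.mul_sum]
  calc ∑ k ∈ s, (s.card : ℝ) ^ (p - 1) * |x k| ^ p
      ≤ ∑ k ∈ s, (p / Real.log p) ^ p * Real.exp (-p) * p *
        (|x k| ^ p * ∏ j ∈ Finset.univ.erase k, (if |x j| ≤ y then 1 else p)) := by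
        refine Finset.sum_le_sum fun k hk => ?_
        refine (mul_le_mul_of_nonneg_right (h2 k hk) (by positivity)).trans_eq ?_
        ring
    _ ≤ _ := Finset.sum_le_univ_sum_of_nonneg fun k => by
        have := hprod0 (Finset.univ.erase k)
        positivity

/-- The large parts of the summands contribute at most `2 (p / ln p) y` to the `p`-norm. -/
theorem lintegral_sum_sub_truncate_rpow_le (hind : iIndepFun η P) (h2 : ∀ k, MemLp (η k) 2 P)
    (h0 : ∀ k, ∫ ω, η k ω ∂P = 0) (hy : 0 < y) (hσ : ∑ k, ∫ ω, η k ω ^ 2 ∂P ≤ y ^ 2)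
    {p : ℝ} (hp : 2 ≤ p)
    (hsum : ∑ k, ∫⁻ ω, ENNReal.ofReal (|η k ω| ^ p) ∂P ≤ ENNReal.ofReal (y ^ p)) :
    ∫⁻ ω, ENNReal.ofReal (|∑ k, (η k ω - truncate y (η k ω))| ^ p) ∂P
      ≤ ENNReal.ofReal ((2 * (p / Real.log p) * y) ^ p) := by
  have hm : ∀ k, AEMeasurable (η k) P := fun k => (h2 k).aestronglyMeasurable.aemeasurable
  have hp0 : 0 < p := by linarith
  have hL : 0 < Real.log p := Real.log_pos (by linarith)
  set C := (p / Real.log p) ^ p * Real.exp (-p) * p with hC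
  have hC0 : 0 ≤ C := by positivity
  set w : ℝ → ℝ := fun x => if |x| ≤ y then 1 else p with hw
  have hw0 : ∀ x, 0 ≤ w x := fun x => by simp only [hw]; split_ifs <;> linarith
  have hwm : Measurable w :=
    Measurable.ite (measurableSet_le (by fun_prop) measurable_const) measurable_const
      measurable_const
  have hwle : ∀ x, w x ≤ 1 + 0 * x + x ^ 2 / y ^ 2 * (p - 1) := by
    intro x
    have hp1 : 0 ≤ p - 1 := by linarith
    simp only [hw]
    split_ifs with h
    · have : 0 ≤ x ^ 2 / y ^ 2 * (p - 1) := by positivity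
      linarith
    · have h3 : 1 ≤ x ^ 2 / y ^ 2 := by
        rw [one_le_div (by positivity), sq_le_sq, abs_of_pos hy]
        exact (not_le.1 h).le
      nlinarith
  -- For fixed `k`, the factors `f k j (η j)` are independent over `j`.
  let f : Fin n → Fin n → ℝ → ℝ≥0∞ := fun k j x =>
    if j = k then ENNReal.ofReal (|x| ^ p) else ENNReal.ofReal (w x)
  have hf : ∀ k j, Measurable (f k j) := fun k j => by
    simp only [f]
    split_ifs
    · exact Measurable.ennreal_ofReal (by fun_prop)
    · exact hwm.ennreal_ofReal
  have hprod : ∀ k (F : Fin n → (ℝ → ℝ≥0∞) → ℝ≥0∞), ∏ j, F j (f k j)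
      = F k (fun x => ENNReal.ofReal (|x| ^ p)) *
        ∏ j ∈ Finset.univ.erase k, F j (fun x => ENNReal.ofReal (w x)) := by
    intro k F
    rw [← Finset.mul_prod_erase Finset.univ _ (Finset.mem_univ k)]
    congr 1
    · simp [f]
    · refine Finset.prod_congr rfl fun j hj => ?_
      simp [f, Finset.ne_of_mem_erase hj]
  have hterm : ∀ k, ∫⁻ ω, ENNReal.ofReal (|η k ω| ^ p * ∏ j ∈ Finset.univ.erase k, w (η j ω)) ∂P
      ≤ (∫⁻ ω, ENNReal.ofReal (|η k ω| ^ p) ∂P) * ENNReal.ofReal (Real.exp (p - 1)) := by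
    intro k
    have e1 : ∀ ω, ENNReal.ofReal (|η k ω| ^ p * ∏ j ∈ Finset.univ.erase k, w (η j ω))
        = ∏ j, f k j (η j ω) := fun ω => by
      rw [hprod k fun j g => g (η j ω), ENNReal.ofReal_mul (by positivity),
        ENNReal.ofReal_prod_of_nonneg fun _ _ => hw0 _]
    simp_rw [e1]
    rw [hind.lintegral_prod_comp hm (hf k), hprod k fun j g => ∫⁻ ω, g (η j ω) ∂P]
    gcongr
    exact prod_lintegral_le_exp (g := fun _ => w) _ (fun _ _ => hw0) (fun _ _ => hwle)
      (by linarith) hy h2 h0 hσ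
  calc ∫⁻ ω, ENNReal.ofReal (|∑ k, (η k ω - truncate y (η k ω))| ^ p) ∂P
      ≤ ∫⁻ ω, ENNReal.ofReal C * ∑ k, ENNReal.ofReal (|η k ω| ^ p *
          ∏ j ∈ Finset.univ.erase k, w (η j ω)) ∂P := by
        refine lintegral_mono fun ω => ?_
        have hn : ∀ k, 0 ≤ |η k ω| ^ p * ∏ j ∈ Finset.univ.erase k, w (η j ω) := fun k =>
          mul_nonneg (by positivity) (Finset.prod_nonneg fun _ _ => hw0 _)
        rw [← ENNReal.ofReal_sum_of_nonneg fun k _ => hn k, ← ENNReal.ofReal_mul hC0]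
        exact ENNReal.ofReal_le_ofReal (abs_sum_sub_truncate_rpow_le hp fun k => η k ω)
    _ = ENNReal.ofReal C * ∑ k, ∫⁻ ω, ENNReal.ofReal (|η k ω| ^ p *
          ∏ j ∈ Finset.univ.erase k, w (η j ω)) ∂P := by
        rw [lintegral_const_mul' _ _ ENNReal.ofReal_ne_top, lintegral_finsetSum']
        intro k _
        refine AEMeasurable.ennreal_ofReal (AEMeasurable.mul ?_ ?_)
        · exact Measurable.comp_aemeasurable (g := fun x : ℝ => |x| ^ p) (by fun_prop) (hm k)
        · exact Finset.aemeasurable_fun_prod _ fun j _ => hwm.comp_aemeasurable (hm j)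
    _ ≤ ENNReal.ofReal C * ∑ k, (∫⁻ ω, ENNReal.ofReal (|η k ω| ^ p) ∂P) *
          ENNReal.ofReal (Real.exp (p - 1)) := by
        gcongr with k; exact hterm k
    _ ≤ ENNReal.ofReal C * (ENNReal.ofReal (y ^ p) * ENNReal.ofReal (Real.exp (p - 1))) := by
        rw [← Finset.sum_mul]; gcongr
    _ = ENNReal.ofReal (C * (y ^ p * Real.exp (p - 1))) := by
        rw [ENNReal.ofReal_mul hC0, ENNReal.ofReal_mul (p := y ^ p) (by positivity)]
    _ ≤ _ := by
        refine ENNReal.ofReal_le_ofReal ?_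
        have e1 : Real.exp (-p) * Real.exp (p - 1) ≤ 1 := by
          rw [← Real.exp_add]; exact Real.exp_le_one_iff.2 (by linarith)
        have e2 : p ≤ 2 ^ p := by
          have h := one_add_mul_self_le_rpow_one_add (s := 1) (by norm_num) (p := p) (by linarith)
          norm_num at h
          linarith
        rw [Real.mul_rpow (by positivity) hy.le, Real.mul_rpow (by norm_num) (by positivity), hC]
        calc (p / Real.log p) ^ p * Real.exp (-p) * p * (y ^ p * Real.exp (p - 1))
            = (p * (Real.exp (-p) * Real.exp (p - 1))) * ((p / Real.log p) ^ p * y ^ p) := by ring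
          _ ≤ (2 ^ p * 1) * ((p / Real.log p) ^ p * y ^ p) := by gcongr
          _ = _ := by ring

theorem eLpNorm_sum_le_of_moments_le (hind : iIndepFun η P) (h2 : ∀ k, MemLp (η k) 2 P)
    (h0 : ∀ k, ∫ ω, η k ω ∂P = 0) (hy : 0 < y) (hσ : ∑ k, ∫ ω, η k ω ^ 2 ∂P ≤ y ^ 2)
    {p : ℝ} (hp : 2 ≤ p)
    (hsum : ∑ k, ∫⁻ ω, ENNReal.ofReal (|η k ω| ^ p) ∂P ≤ ENNReal.ofReal (y ^ p)) :
    eLpNorm (fun ω => ∑ k, η k ω) (ENNReal.ofReal p) P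
      ≤ ENNReal.ofReal (3 * (p / Real.log p) * y) := by
  have hm : ∀ k, AEMeasurable (η k) P := fun k => (h2 k).aestronglyMeasurable.aemeasurable
  have hp0 : 0 < p := by linarith
  have hL : 0 < Real.log p := Real.log_pos (by linarith)
  have hA := eLpNorm_le_of_lintegral_le hp0 (by positivity)
    (lintegral_sum_truncate_rpow_le hind h2 h0 hy hσ hp)
  have hB := eLpNorm_le_of_lintegral_le hp0 (by positivity)
    (lintegral_sum_sub_truncate_rpow_le hind h2 h0 hy hσ hp hsum)
  have ht : ∀ k, AEMeasurable (fun ω => truncate y (η k ω)) P := fun k =>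
    (measurable_truncate y).comp_aemeasurable (hm k)
  have e : (fun ω => ∑ k, η k ω) = (fun ω => ∑ k, truncate y (η k ω))
      + fun ω => ∑ k, (η k ω - truncate y (η k ω)) := by
    ext ω
    simp [Finset.sum_sub_distrib]
  rw [e]
  refine (eLpNorm_add_le (Finset.aemeasurable_fun_sum _ fun k _ => ht k).aestronglyMeasurable
    (Finset.aemeasurable_fun_sum _ fun k _ => (hm k).sub (ht k)).aestronglyMeasurable
    (ENNReal.one_le_ofReal.2 (by linarith))).trans ((add_le_add hA hB).trans_eq ?_)
  rw [← ENNReal.ofReal_add (by positivity) (by positivity)]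
  congr 1
  ring

/-! ### Rosenthal's inequality -/

theorem integral_sum_sq_eq (hind : iIndepFun η P) (h2 : ∀ k, MemLp (η k) 2 P)
    (h0 : ∀ k, ∫ ω, η k ω ∂P = 0) :
    ∫ ω, (∑ k, η k ω) ^ 2 ∂P = ∑ k, ∫ ω, η k ω ^ 2 ∂P := by
  have hS2 : MemLp (fun ω => ∑ k, η k ω) 2 P := memLp_finsetSum _ fun k _ => h2 k
  have h3 := IndepFun.variance_sum (s := Finset.univ) (X := η) (fun k _ => h2 k)
    fun i _ j _ hij => hind.indepFun hij
  have e1 : ∀ k, Var[η k; P] = ∫ ω, η k ω ^ 2 ∂P := fun k =>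
    variance_of_integral_eq_zero (h2 k).aestronglyMeasurable.aemeasurable (h0 k)
  have e2 : (∑ k, η k) = fun ω => ∑ k, η k ω := by ext ω; simp
  rw [e2, variance_of_integral_eq_zero hS2.aestronglyMeasurable.aemeasurable] at h3
  · simpa [e1] using h3
  · rw [integral_finsetSum _ fun k _ => (h2 k).integrable (by norm_num)]
    simp [h0]

theorem eLpNorm_two_sum_sq (hind : iIndepFun η P) (h2 : ∀ k, MemLp (η k) 2 P)
    (h0 : ∀ k, ∫ ω, η k ω ∂P = 0) :
    eLpNorm (fun ω => ∑ k, η k ω) 2 P ^ 2 = ∑ k, eLpNorm (η k) 2 P ^ 2 := by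
  rw [eLpNorm_two_sq (memLp_finsetSum _ fun k _ => h2 k), integral_sum_sq_eq hind h2 h0,
    ENNReal.ofReal_sum_of_nonneg fun k _ => integral_nonneg fun ω => sq_nonneg _]
  exact Finset.sum_congr rfl fun k _ => (eLpNorm_two_sq (h2 k)).symm

theorem rosenthal_max_ne_top {p : ℝ} (hp : 2 ≤ p)
    (hη : ∀ k, MemLp (η k) (ENNReal.ofReal p) P) :
    max (eLpNorm (fun ω => ∑ k, η k ω) 2 P)
      ((∑ k, eLpNorm (η k) (ENNReal.ofReal p) P ^ p) ^ (1 / p)) ≠ ∞ := by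
  have hp0 : 0 < p := by linarith
  have hS2 : MemLp (fun ω => ∑ k, η k ω) 2 P := memLp_finsetSum _ fun k _ =>
    (hη k).mono_exponent (by simpa using ENNReal.ofReal_le_ofReal hp)
  refine (max_lt hS2.2 (ENNReal.rpow_lt_top_of_nonneg (by positivity) ?_)).ne
  exact ENNReal.sum_ne_top.2 fun k _ => ENNReal.rpow_ne_top_of_nonneg hp0.le (hη k).2.ne

/-- Rosenthal's inequality with the optimal rate `p / ln p` and the constant `3`. -/
theorem rosenthal_inequality (hind : iIndepFun η P) {p : ℝ} (hp : 2 ≤ p)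
    (hη : ∀ k, MemLp (η k) (ENNReal.ofReal p) P) (h0 : ∀ k, ∫ ω, η k ω ∂P = 0) :
    eLpNorm (fun ω => ∑ k, η k ω) (ENNReal.ofReal p) P ≤
      ENNReal.ofReal (3 * (p / Real.log p)) *
        max (eLpNorm (fun ω => ∑ k, η k ω) 2 P)
          ((∑ k, eLpNorm (η k) (ENNReal.ofReal p) P ^ p) ^ (1 / p)) := by
  have hp0 : 0 < p := by linarith
  have hL : 0 < Real.log p := Real.log_pos (by linarith)
  have hp1 : (1 : ℝ≥0∞) ≤ ENNReal.ofReal p := ENNReal.one_le_ofReal.2 (by linarith)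
  have hp2 : (2 : ℝ≥0∞) ≤ ENNReal.ofReal p := by
    simpa using ENNReal.ofReal_le_ofReal hp
  have h2 : ∀ k, MemLp (η k) 2 P := fun k => (hη k).mono_exponent hp2
  have hS2 : MemLp (fun ω => ∑ k, η k ω) 2 P := memLp_finsetSum _ fun k _ => h2 k
  set M := max (eLpNorm (fun ω => ∑ k, η k ω) 2 P)
    ((∑ k, eLpNorm (η k) (ENNReal.ofReal p) P ^ p) ^ (1 / p)) with hM
  have hpk : ∀ k, ∫⁻ ω, ENNReal.ofReal (|η k ω| ^ p) ∂P
      = eLpNorm (η k) (ENNReal.ofReal p) P ^ p := fun k => by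
    rw [eLpNorm_eq_lintegral_ofReal_abs hp0, ← ENNReal.rpow_mul, one_div_mul_cancel hp0.ne',
      ENNReal.rpow_one]
  have hMtop : M ≠ ∞ := rosenthal_max_ne_top hp hη
  -- The truncation level has to be positive, so it is chosen slightly above `M`.
  have hbound : ∀ y : ℝ, M.toReal < y → eLpNorm (fun ω => ∑ k, η k ω) (ENNReal.ofReal p) P ≤
      ENNReal.ofReal (3 * (p / Real.log p) * y) := by
    intro y hyM
    have hy : 0 < y := ENNReal.toReal_nonneg.trans_lt hyM
    have hMy : M ≤ ENNReal.ofReal y := by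
      rw [← ENNReal.ofReal_toReal hMtop]; exact ENNReal.ofReal_le_ofReal hyM.le
    refine eLpNorm_sum_le_of_moments_le hind h2 h0 hy ?_ hp ?_
    · have h5 := pow_le_pow_left' ((le_max_left _ _).trans hMy) 2
      rw [eLpNorm_two_sq hS2, integral_sum_sq_eq hind h2 h0, ← ENNReal.ofReal_pow hy.le] at h5
      exact (ENNReal.ofReal_le_ofReal_iff (by positivity)).1 h5
    · simp_rw [hpk]
      have h5 := ENNReal.rpow_le_rpow ((le_max_right _ _).trans hMy) hp0.le
      rwa [← ENNReal.rpow_mul, one_div_mul_cancel hp0.ne', ENNReal.rpow_one,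
        ENNReal.ofReal_rpow_of_nonneg hy.le hp0.le] at h5
  have hlim : Tendsto (fun y => ENNReal.ofReal (3 * (p / Real.log p) * y)) (𝓝[>] M.toReal)
      (𝓝 (ENNReal.ofReal (3 * (p / Real.log p) * M.toReal))) :=
    (ENNReal.continuous_ofReal.comp (continuous_const.mul continuous_id)).continuousAt.mono_left
      nhdsWithin_le_nhds
  have h8 := ge_of_tendsto hlim (eventually_nhdsWithin_of_forall hbound)
  rwa [ENNReal.ofReal_mul (by positivity), ENNReal.ofReal_toReal hMtop] at h8

end Rosenthal

theorem isRosenthalBound_three : IsRosenthalBound 3 :=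
  ⟨by norm_num, fun _ hp _ _ _ _ _ _ hη h0 hind => rosenthal_inequality hind hp hη h0⟩

/-! ### Multilinear forms in independent random vectors -/

/-- Minkowski's inequality in `L^{p/2}` for the functions `a k ^ 2`. -/
theorem eLpNorm_sqrt_sum_sq_le {Ω : Type*} [MeasurableSpace Ω] {P : Measure Ω} {N : ℕ}
    {p : ℝ} (hp : 2 ≤ p) {a : Fin N → Ω → ℝ} (ha : ∀ k, Measurable (a k)) :
    eLpNorm (fun ω => √(∑ k, a k ω ^ 2)) (ENNReal.ofReal p) P ^ 2
      ≤ ∑ k, eLpNorm (a k) (ENNReal.ofReal p) P ^ 2 := by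
  have hp' : ENNReal.ofReal (p / 2) * ENNReal.ofReal 2 = ENNReal.ofReal p := by
    rw [← ENNReal.ofReal_mul (by linarith), div_mul_cancel₀ _ (by norm_num)]
  have hsq : ∀ f : Ω → ℝ, eLpNorm f (ENNReal.ofReal p) P ^ 2
      = eLpNorm (fun ω => f ω ^ 2) (ENNReal.ofReal (p / 2)) P := by
    intro f
    have h := eLpNorm_norm_rpow (μ := P) (p := ENNReal.ofReal (p / 2)) f (q := 2) (by norm_num)
    rw [hp'] at h
    simpa using h.symm
  simp_rw [hsq]
  have e : (fun ω => √(∑ k, a k ω ^ 2) ^ 2) = ∑ k, fun ω => a k ω ^ 2 := by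
    ext ω
    rw [Real.sq_sqrt (Finset.sum_nonneg fun k _ => sq_nonneg _)]
    simp
  rw [e]
  exact eLpNorm_sum_le (fun k _ => ((ha k).pow_const 2).aestronglyMeasurable)
    (ENNReal.one_le_ofReal.2 (by linarith))

/-- A moment bound for linear forms with deterministic coefficients, applied conditionally on the
coordinate `y` on which the coefficients `A k y` depend. -/
theorem eLpNorm_prod_linear_le {β : Type*} [MeasurableSpace β] {N : ℕ} {p : ℝ} (hp : 2 ≤ p)
    (μ : Measure (Fin N → ℝ)) [SFinite μ] (ν : Measure β) [SFinite ν] {M : ℝ≥0∞}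
    (hμ : ∀ a : Fin N → ℝ, eLpNorm (fun x : Fin N → ℝ => ∑ k, a k * x k) (ENNReal.ofReal p) μ
      ≤ M * ENNReal.ofReal √(∑ k, a k ^ 2))
    {A : Fin N → β → ℝ} (hA : ∀ k, Measurable (A k)) :
    eLpNorm (fun z : (Fin N → ℝ) × β => ∑ k, A k z.2 * z.1 k) (ENNReal.ofReal p) (μ.prod ν)
      ≤ M * eLpNorm (fun y => √(∑ k, A k y ^ 2)) (ENNReal.ofReal p) ν := by
  have hp0 : 0 < p := by linarith
  have hmS : Measurable fun z : (Fin N → ℝ) × β => ∑ k, A k z.2 * z.1 k :=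
    Finset.measurable_fun_sum _ fun k _ => ((hA k).comp measurable_snd).mul
      ((measurable_pi_apply k).comp measurable_fst)
  have hmQ : Measurable fun y => √(∑ k, A k y ^ 2) :=
    (Finset.measurable_fun_sum _ fun k _ => (hA k).pow_const 2).sqrt
  rw [eLpNorm_eq_lintegral_ofReal_abs hp0, eLpNorm_eq_lintegral_ofReal_abs hp0]
  have hM : M = (M ^ p) ^ (1 / p) := by
    rw [← ENNReal.rpow_mul, mul_one_div_cancel hp0.ne', ENNReal.rpow_one]
  rw [hM, ← ENNReal.mul_rpow_of_nonneg _ _ (by positivity : 0 ≤ 1 / p)]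
  gcongr
  rw [lintegral_prod_symm' _ (Measurable.ennreal_ofReal (hmS.abs.pow_const p)),
    ← lintegral_const_mul _ (Measurable.ennreal_ofReal (hmQ.abs.pow_const p))]
  refine lintegral_mono fun y => ?_
  have h := ENNReal.rpow_le_rpow (hμ fun k => A k y) hp0.le
  rw [eLpNorm_eq_lintegral_ofReal_abs hp0, ← ENNReal.rpow_mul, one_div_mul_cancel hp0.ne',
    ENNReal.rpow_one, ENNReal.mul_rpow_of_nonneg _ _ hp0.le,
    ENNReal.ofReal_rpow_of_nonneg (Real.sqrt_nonneg _) hp0.le] at h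
  simpa only [abs_of_nonneg (Real.sqrt_nonneg _)] using h

/-- If the random vectors `x 0, …, x (d - 1)` are independent and each satisfies
`|∑ₖ aₖ x m k|_p ≤ M m |a|` for deterministic `a`, then the multilinear forms in them satisfy
`|∑ᵢ bᵢ ∏ₛ x s (i s)|_p ≤ (∏ₘ M m) |b|`. -/
theorem eLpNorm_multilinear_le {N : ℕ} {p : ℝ} (hp : 2 ≤ p) {d : ℕ}
    (ν : Fin d → Measure (Fin N → ℝ)) [∀ m, IsProbabilityMeasure (ν m)] (M : Fin d → ℝ≥0∞)
    (hν : ∀ m, ∀ a : Fin N → ℝ, eLpNorm (fun x : Fin N → ℝ => ∑ k, a k * x k)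
      (ENNReal.ofReal p) (ν m) ≤ M m * ENNReal.ofReal √(∑ k, a k ^ 2))
    (b : (Fin d → Fin N) → ℝ) :
    eLpNorm (fun x : Fin d → Fin N → ℝ => ∑ i, b i * ∏ s, x s (i s)) (ENNReal.ofReal p)
      (Measure.pi ν) ≤ (∏ m, M m) * ENNReal.ofReal √(∑ i, b i ^ 2) := by
  have hp0 : 0 < p := by linarith
  induction d with
  | zero =>
    simp only [Finset.univ_eq_empty, Finset.prod_empty, mul_one, one_mul]
    rw [eLpNorm_const _ (by simpa using hp0) (IsProbabilityMeasure.ne_zero _)]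
    simp [Real.sqrt_sq_eq_abs, Real.enorm_eq_ofReal_abs]
  | succ d ih =>
    let A : Fin N → (Fin d → Fin N → ℝ) → ℝ := fun k x =>
      ∑ i : Fin d → Fin N, b (Fin.cons k i) * ∏ s, x s (i s)
    have hA : ∀ k, Measurable (A k) := fun k =>
      Finset.measurable_fun_sum _ fun i _ => (Finset.measurable_fun_prod _ fun s _ => by
        fun_prop).const_mul _
    have hmp := (measurePreserving_piFinSuccAbove ν 0).symm
    have hmeas : Measurable fun x : Fin (d + 1) → Fin N → ℝ => ∑ i, b i * ∏ s, x s (i s) :=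
      Finset.measurable_fun_sum _ fun i _ => (Finset.measurable_fun_prod _ fun s _ => by
        fun_prop).const_mul _
    have hsum : ∀ F : (Fin (d + 1) → Fin N) → ℝ,
        ∑ i, F i = ∑ k, ∑ i : Fin d → Fin N, F (Fin.cons k i) := fun F => by
      rw [← Fintype.sum_prod_type']
      exact (Fintype.sum_equiv (Fin.consEquiv fun _ => Fin N) _ _ fun _ => rfl).symm
    rw [← eLpNorm_comp_measurePreserving hmeas.aestronglyMeasurable hmp]
    have e : (fun x : Fin (d + 1) → Fin N → ℝ => ∑ i, b i * ∏ s, x s (i s)) ∘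
        (MeasurableEquiv.piFinSuccAbove (fun _ => Fin N → ℝ) 0).symm
        = fun z => ∑ k, A k z.2 * z.1 k := by
      ext z
      simp only [Function.comp_apply, MeasurableEquiv.piFinSuccAbove_symm_apply, hsum, A,
        Finset.sum_mul, Fin.prod_univ_succ, Fin.insertNthEquiv_apply, Fin.insertNth_zero',
        Fin.cons_zero, Fin.cons_succ]
      exact Finset.sum_congr rfl fun k _ => Finset.sum_congr rfl fun i _ => by ring
    rw [e]
    refine (eLpNorm_prod_linear_le hp _ _ (hν 0) hA).trans ?_
    rw [Fin.prod_univ_succ, mul_assoc]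
    gcongr
    refine (ENNReal.pow_le_pow_left_iff two_ne_zero).1 ((eLpNorm_sqrt_sum_sq_le hp hA).trans ?_)
    have hk : ∀ k, eLpNorm (A k) (ENNReal.ofReal p) (Measure.pi fun j => ν (Fin.succAbove 0 j)) ^ 2
        ≤ (∏ m : Fin d, M m.succ) ^ 2 *
          ENNReal.ofReal (∑ i : Fin d → Fin N, b (Fin.cons k i) ^ 2) := fun k => by
      refine (pow_le_pow_left' (ih (fun j => ν (Fin.succAbove 0 j)) (fun m => M m.succ)
        (fun m => hν m.succ) fun i => b (Fin.cons k i)) 2).trans_eq ?_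
      rw [mul_pow, ← ENNReal.ofReal_pow (Real.sqrt_nonneg _),
        Real.sq_sqrt (Finset.sum_nonneg fun _ _ => sq_nonneg _)]
    refine (Finset.sum_le_sum fun k _ => hk k).trans_eq ?_
    rw [← Finset.mul_sum, mul_pow, ← ENNReal.ofReal_pow (Real.sqrt_nonneg _),
      Real.sq_sqrt (Finset.sum_nonneg fun _ _ => sq_nonneg _), hsum,
      ENNReal.ofReal_sum_of_nonneg fun _ _ => Finset.sum_nonneg fun _ _ => sq_nonneg _]

/-! ### Rosenthal's constant -/

theorem rosenthalConstant_nonneg : 0 ≤ rosenthalConstant :=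
  Real.sInf_nonneg fun _ hC => hC.1

theorem rosenthalConstant_le_three : rosenthalConstant ≤ 3 :=
  csInf_le ⟨0, fun _ hC => hC.1⟩ isRosenthalBound_three

/-- The infimum defining Rosenthal's constant is attained. -/
theorem isRosenthalBound_rosenthalConstant : IsRosenthalBound rosenthalConstant := by
  refine ⟨rosenthalConstant_nonneg, fun p hp Ω _ P _ n η hη h0 hind => ?_⟩
  obtain ⟨u, -, hu, hmem⟩ := exists_seq_tendsto_sInf (S := {C : ℝ | IsRosenthalBound C})
    ⟨3, isRosenthalBound_three⟩ ⟨0, fun _ hC => hC.1⟩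
  refine ge_of_tendsto' (ENNReal.Tendsto.mul_const (ENNReal.tendsto_ofReal (hu.mul_const _))
    (Or.inr (rosenthal_max_ne_top hp hη))) fun j => ?_
  exact (hmem j).2 p hp Ω _ P inferInstance n η hη h0 hind

theorem ENNReal.sum_rpow_le_rpow_sum {ι : Type*} (s : Finset ι) (u : ι → ℝ≥0∞) {q : ℝ}
    (hq : 1 ≤ q) : ∑ k ∈ s, u k ^ q ≤ (∑ k ∈ s, u k) ^ q := by
  classical
  induction s using Finset.induction_on with
  | empty => simp
  | insert a s ha ih =>
    rw [Finset.sum_insert ha, Finset.sum_insert ha]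
    exact (add_le_add le_rfl ih).trans (ENNReal.add_rpow_le_rpow_add _ _ hq)

/-- For `p ≥ 2` both terms of the maximum in Rosenthal's inequality are at most
`(∑ₖ |ηₖ|_p²)^{1/2}`. -/
theorem eLpNorm_sum_le_rosenthalConstant {Ω : Type} [MeasurableSpace Ω] {P : Measure Ω}
    [IsProbabilityMeasure P] {n : ℕ} {η : Fin n → Ω → ℝ} {p : ℝ} (hp : 2 ≤ p)
    (hη : ∀ k, MemLp (η k) (ENNReal.ofReal p) P) (h0 : ∀ k, ∫ ω, η k ω ∂P = 0)
    (hind : iIndepFun η P) :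
    eLpNorm (fun ω => ∑ k, η k ω) (ENNReal.ofReal p) P ≤
      ENNReal.ofReal (rosenthalConstant * (p / Real.log p)) *
        (∑ k, eLpNorm (η k) (ENNReal.ofReal p) P ^ 2) ^ (1 / 2 : ℝ) := by
  have hp0 : 0 < p := by linarith
  have hp2 : (2 : ℝ≥0∞) ≤ ENNReal.ofReal p := by
    simpa using ENNReal.ofReal_le_ofReal hp
  refine (isRosenthalBound_rosenthalConstant.2 p hp Ω _ P inferInstance n η hη h0 hind).trans ?_
  gcongr
  refine max_le ?_ ?_
  · have h := eLpNorm_two_sum_sq hind (fun k => (hη k).mono_exponent hp2) h0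
    have e : eLpNorm (fun ω => ∑ k, η k ω) 2 P
        = (eLpNorm (fun ω => ∑ k, η k ω) 2 P ^ 2) ^ (1 / 2 : ℝ) := by
      rw [← ENNReal.rpow_natCast, ← ENNReal.rpow_mul]
      norm_num
    rw [e, h]
    gcongr with k
    exact eLpNorm_le_eLpNorm_of_exponent_le hp2 (hη k).aestronglyMeasurable
  · have h := ENNReal.sum_rpow_le_rpow_sum Finset.univ
      (fun k => eLpNorm (η k) (ENNReal.ofReal p) P ^ 2) (q := p / 2) (by linarith)
    have e : ∀ k, (eLpNorm (η k) (ENNReal.ofReal p) P ^ 2) ^ (p / 2)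
        = eLpNorm (η k) (ENNReal.ofReal p) P ^ p := fun k => by
      rw [← ENNReal.rpow_natCast, ← ENNReal.rpow_mul]
      congr 1
      push_cast
      ring
    simp only [e] at h
    refine (ENNReal.rpow_le_rpow h (by positivity)).trans_eq ?_
    rw [← ENNReal.rpow_mul]
    congr 1
    field_simp

theorem eLpNorm_linear_le {N : ℕ} {p : ℝ} (hp : 2 ≤ p) (ν : Fin N → Measure ℝ)
    [∀ k, IsProbabilityMeasure (ν k)] (h0 : ∀ k, ∫ x, x ∂ν k = 0) {μ : ℝ≥0∞} (hμ : μ ≠ ∞)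
    (hν : ∀ k, eLpNorm (fun x => x) (ENNReal.ofReal p) (ν k) ≤ μ) (a : Fin N → ℝ) :
    eLpNorm (fun x : Fin N → ℝ => ∑ k, a k * x k) (ENNReal.ofReal p) (Measure.pi ν) ≤
      ENNReal.ofReal (rosenthalConstant * (p / Real.log p)) * μ *
        ENNReal.ofReal √(∑ k, a k ^ 2) := by
  have hmp := fun k => measurePreserving_eval ν k
  have hind : iIndepFun (fun k (x : Fin N → ℝ) => a k * x k) (Measure.pi ν) :=
    iIndepFun_pi (X := fun k x => a k * x) fun k => by fun_prop
  have hnorm : ∀ k, eLpNorm (fun x : Fin N → ℝ => a k * x k) (ENNReal.ofReal p) (Measure.pi ν)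
      ≤ ENNReal.ofReal |a k| * μ := fun k => by
    have e1 : eLpNorm (fun x : Fin N → ℝ => x k) (ENNReal.ofReal p) (Measure.pi ν)
        = eLpNorm (fun x => x) (ENNReal.ofReal p) (ν k) :=
      eLpNorm_comp_measurePreserving (g := fun x : ℝ => x) measurable_id.aestronglyMeasurable
        (hmp k)
    have e2 := eLpNorm_const_smul (a k) (fun x : Fin N → ℝ => x k) (ENNReal.ofReal p)
      (Measure.pi ν)
    rw [e1, Real.enorm_eq_ofReal_abs] at e2
    exact e2.trans_le (by gcongr; exact hν k)
  have hmem : ∀ k, MemLp (fun x : Fin N → ℝ => a k * x k) (ENNReal.ofReal p) (Measure.pi ν) :=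
    fun k => ⟨((measurable_pi_apply k).const_mul _).aestronglyMeasurable,
      (hnorm k).trans_lt (ENNReal.mul_lt_top ENNReal.ofReal_lt_top hμ.lt_top)⟩
  have hcent : ∀ k, ∫ x : Fin N → ℝ, a k * x k ∂Measure.pi ν = 0 := fun k => by
    have e1 : ∫ x : Fin N → ℝ, x k ∂Measure.pi ν = ∫ x, x ∂ν k := by
      have hid : AEStronglyMeasurable (fun x : ℝ => x) ((Measure.pi ν).map (Function.eval k)) :=
        measurable_id.aestronglyMeasurable
      rw [← (hmp k).map_eq]
      exact (integral_map (hmp k).measurable.aemeasurable hid).symm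
    rw [integral_const_mul, e1, h0 k, mul_zero]
  refine (eLpNorm_sum_le_rosenthalConstant hp hmem hcent hind).trans ?_
  rw [mul_assoc]
  gcongr
  calc (∑ k, eLpNorm (fun x : Fin N → ℝ => a k * x k) (ENNReal.ofReal p) (Measure.pi ν) ^ 2)
        ^ (1 / 2 : ℝ)
      ≤ (∑ k, (ENNReal.ofReal |a k| * μ) ^ 2) ^ (1 / 2 : ℝ) := by
        gcongr with k; exact hnorm k
    _ = (μ ^ 2 * ENNReal.ofReal (∑ k, a k ^ 2)) ^ (1 / 2 : ℝ) := by
        rw [ENNReal.ofReal_sum_of_nonneg fun _ _ => sq_nonneg _, Finset.mul_sum]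
        congr 1
        refine Finset.sum_congr rfl fun k _ => ?_
        rw [mul_pow, ← ENNReal.ofReal_pow (abs_nonneg _), sq_abs, mul_comm]
    _ = _ := by
        rw [ENNReal.mul_rpow_of_nonneg _ _ (by norm_num), ENNReal.ofReal_rpow_of_nonneg
          (Finset.sum_nonneg fun _ _ => sq_nonneg _) (by norm_num), ← Real.sqrt_eq_rpow,
          ← ENNReal.rpow_natCast, ← ENNReal.rpow_mul]
        norm_num

/-! ### Osekowski's constant and comparison of the constants -/

theorem bddAbove_osekowski :
    BddAbove ((fun p : ℝ => osekowskiFunction p / (p / Real.log p)) '' Set.Ici 4) := by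
  refine ⟨4 * √2 * Real.exp 1 * 3, ?_⟩
  rintro _ ⟨p, hp, rfl⟩
  have hp4 : (4 : ℝ) ≤ p := hp
  have hp0 : 0 < p := by linarith
  have hL : 0 < Real.log p := Real.log_pos (by linarith)
  have hL2 : 0 < Real.log (p / 2) := Real.log_pos (by linarith)
  have h1 : (p / 4 + 1) ^ (1 / p) ≤ Real.exp 1 := by
    have h : p / 4 + 1 ≤ Real.exp p := by
      have := Real.add_one_le_exp p; linarith
    calc (p / 4 + 1) ^ (1 / p) ≤ (Real.exp p) ^ (1 / p) := by gcongr
      _ = Real.exp 1 := by rw [← Real.exp_mul, mul_one_div_cancel hp0.ne']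
  have h2 : Real.log p / p ≤ 1 := by
    rw [div_le_one hp0]
    have := Real.log_le_sub_one_of_pos hp0; linarith
  have h3 : Real.log p / Real.log (p / 2) ≤ 2 := by
    rw [div_le_iff₀ hL2]
    have h : Real.log p ≤ Real.log ((p / 2) ^ 2) := Real.log_le_log hp0 (by nlinarith)
    rw [Real.log_pow] at h
    exact_mod_cast h
  calc osekowskiFunction p / (p / Real.log p)
      = 4 * √2 * (p / 4 + 1) ^ (1 / p) *
        (Real.log p / p + Real.log p / Real.log (p / 2)) := by
        unfold osekowskiFunction
        field_simp
    _ ≤ 4 * √2 * Real.exp 1 * 3 := by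
        gcongr
        linarith

theorem eight_le_osekowskiConstant : 8 ≤ osekowskiConstant := by
  refine le_trans ?_ (le_csSup bddAbove_osekowski ⟨4, Set.self_mem_Ici, rfl⟩)
  have hl2 : 0 < Real.log 2 := Real.log_pos (by norm_num)
  have hl4 : Real.log 4 = 2 * Real.log 2 := by
    rw [show (4 : ℝ) = 2 ^ 2 by norm_num, Real.log_pow]; norm_num
  have h1 : 1 ≤ √2 := Real.one_le_sqrt.2 (by norm_num)
  have h2 : (1 : ℝ) ≤ (4 / 4 + 1) ^ (1 / 4 : ℝ) :=
    Real.one_le_rpow (by norm_num) (by norm_num)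
  calc (8 : ℝ) ≤ 1 * 1 * (2 * Real.log 2 + 8) := by linarith
    _ ≤ √2 * (4 / 4 + 1) ^ (1 / 4 : ℝ) * (2 * Real.log 2 + 8) := by gcongr
    _ = osekowskiFunction 4 / (4 / Real.log 4) := by
      unfold osekowskiFunction
      rw [hl4, show (4 / 2 : ℝ) = 2 by norm_num]
      field_simp
      ring

/-- Each step of the recursion for `κ` multiplies by at least `K_Os ≥ 8`, while `K_R ≤ 3`. -/
theorem rosenthalConstant_pow_le_kappa {d : ℕ} (hd : 1 ≤ d) : rosenthalConstant ^ d ≤ kappa d := by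
  have hK := rosenthalConstant_nonneg
  induction d, hd using Nat.le_induction with
  | base => simp [kappa]
  | succ d hd ih =>
    obtain ⟨e, rfl⟩ : ∃ e, d = e + 1 := ⟨d - 1, by omega⟩
    have h1 : (1 : ℝ) ≤ (1 + 1 / ((e + 1 : ℕ) : ℝ)) ^ (e + 1) :=
      one_le_pow₀ (by linarith [show (0 : ℝ) ≤ 1 / ((e + 1 : ℕ) : ℝ) by positivity])
    have h2 : rosenthalConstant ≤ osekowskiConstant :=
      rosenthalConstant_le_three.trans (le_trans (by norm_num) eight_le_osekowskiConstant)
    have h0 : 0 ≤ osekowskiConstant := hK.trans h2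
    have hk : 0 ≤ kappa (e + 1) := le_trans (by positivity) ih
    calc rosenthalConstant ^ (e + 1 + 1)
        = rosenthalConstant ^ (e + 1) * rosenthalConstant * 1 := by ring
      _ ≤ kappa (e + 1) * osekowskiConstant * (1 + 1 / ((e + 1 : ℕ) : ℝ)) ^ (e + 1) := by
        gcongr

/-! ### Random polynomials -/

/-- Indices in `{1, …, N}` are shifted to `Fin N`. -/
theorem sum_indexSet_eq {M : Type*} [AddCommMonoid M] (d N : ℕ) (F : (Fin d → ℕ) → M)
    [DecidablePred fun i : Fin d → Fin N => StrictMono i] :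
    ∑ i ∈ (indexSet_finite d N).toFinset, F i
      = ∑ i : Fin d → Fin N, if StrictMono i then F (fun s => i s + 1) else 0 := by
  rw [← Finset.sum_filter]
  symm
  refine Finset.sum_bij (fun i _ s => (i s : ℕ) + 1) ?_ ?_ ?_ fun _ _ => rfl
  · intro i hi
    have hi' : StrictMono i := by simpa using hi
    rw [Set.Finite.mem_toFinset]
    refine ⟨fun s t hst => Nat.add_lt_add_right (hi' hst) 1, fun s => ⟨Nat.le_add_left 1 _, ?_⟩⟩
    exact_mod_cast (i s).isLt
  · intro i _ j _ hij
    ext s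
    have := congrFun hij s
    simpa using this
  · intro j hj
    rw [Set.Finite.mem_toFinset] at hj
    have hj2 : ∀ s, 1 ≤ j s ∧ j s ≤ N := fun s => ⟨(hj.2 s).1, by exact_mod_cast (hj.2 s).2⟩
    refine ⟨fun s => ⟨j s - 1, by have := hj2 s; omega⟩, ?_, ?_⟩
    · simp only [Finset.mem_filter, Finset.mem_univ, true_and]
      intro s t hst
      have h1 := hj.1 hst
      have h2 := hj2 s
      simp only [Fin.mk_lt_mk]
      omega
    · ext s
      have := hj2 s
      simp only
      omega

theorem aestronglyMeasurable_randomPolynomial {Ω : Type*} [MeasurableSpace Ω] {P : Measure Ω}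
    {d : ℕ} {n : ℕ∞} {ξ : ℕ → Fin d → Ω → ℝ}
    (hmeas : ∀ i : ℕ, 1 ≤ i → (i : ℕ∞) ≤ n → ∀ m, AEMeasurable (ξ i m) P)
    (b : (Fin d → ℕ) → ℝ) {N : ℕ} (hN : (N : ℕ∞) ≤ n) :
    AEStronglyMeasurable (randomPolynomial ξ b N) P := by
  unfold randomPolynomial
  refine (Finset.aemeasurable_fun_sum _ fun i hi => ?_).aestronglyMeasurable
  rw [Set.Finite.mem_toFinset] at hi
  exact (Finset.aemeasurable_fun_prod _ fun s _ =>
    hmeas _ (hi.2 s).1 ((hi.2 s).2.trans hN) s).const_mul _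

section RandomPolynomial

variable {Ω : Type*} [MeasurableSpace Ω] {P : Measure Ω} [IsProbabilityMeasure P]
  {d : ℕ} {n : ℕ∞} {ξ : ℕ → Fin d → Ω → ℝ}

/-- The joint law of a jointly independent doubly indexed family, as an iterated product. -/
theorem map_eq_pi_pi {N : ℕ} {X : Fin d → Fin N → Ω → ℝ} (hm : ∀ m k, AEMeasurable (X m k) P)
    (hind : iIndepFun (fun q : Fin d × Fin N => X q.1 q.2) P) :
    P.map (fun ω m k => X m k ω) = Measure.pi fun m => Measure.pi fun k => P.map (X m k) := by
  have hprob : ∀ m k, IsProbabilityMeasure (P.map (X m k)) := fun m k =>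
    Measure.isProbabilityMeasure_map (hm m k)
  have h1 := hind.map_fun_eq_infinitePi_map₀' fun q : Fin d × Fin N => hm q.1 q.2
  have h2 := Measure.infinitePi_map_curry fun m k => P.map (X m k)
  have hm' : AEMeasurable (fun ω (q : Fin d × Fin N) => X q.1 q.2 ω) P :=
    aemeasurable_pi_iff.2 fun q => hm q.1 q.2
  rw [← h1, AEMeasurable.map_map_of_aemeasurable (MeasurableEquiv.measurable _).aemeasurable hm']
    at h2
  simp_rw [Measure.infinitePi_eq_pi] at h2
  exact h2

/-- The moment bound for finite polynomials, with `K_R ^ d` in place of `κ(d)`. -/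
theorem eLpNorm_randomPolynomial_le {p : ℝ} (hp : 2 ≤ p)
    (hmeas : ∀ i : ℕ, 1 ≤ i → (i : ℕ∞) ≤ n → ∀ m, AEMeasurable (ξ i m) P)
    (hcent : ∀ i : ℕ, 1 ≤ i → (i : ℕ∞) ≤ n → ∀ m, ∫ ω, ξ i m ω ∂P = 0)
    (hindep : iIndepFun
      (fun k : {i : ℕ // 1 ≤ i ∧ (i : ℕ∞) ≤ n} × Fin d => ξ k.1 k.2) P)
    (hfin : ∀ m, momentMax P n ξ m p < ∞) (b : (Fin d → ℕ) → ℝ) {N : ℕ} (hN : (N : ℕ∞) ≤ n) :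
    eLpNorm (randomPolynomial ξ b N) (ENNReal.ofReal p) P ≤
      ENNReal.ofReal ((rosenthalConstant * (p / Real.log p)) ^ d) *
        (∏ m, momentMax P n ξ m p) *
        ENNReal.ofReal √(∑ i ∈ (indexSet_finite d N).toFinset, b i ^ 2) := by
  classical
  have hK := rosenthalConstant_nonneg
  have hL : 0 < Real.log p := Real.log_pos (by linarith)
  have hle : ∀ k : Fin N, 1 ≤ (k : ℕ) + 1 ∧ (((k : ℕ) + 1 : ℕ) : ℕ∞) ≤ n := fun k =>
    ⟨by omega, le_trans (by exact_mod_cast k.isLt) hN⟩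
  let X : Fin d → Fin N → Ω → ℝ := fun m k => ξ (k + 1) m
  have hm : ∀ m k, AEMeasurable (X m k) P := fun m k => hmeas _ (hle k).1 (hle k).2 m
  have hprob : ∀ m k, IsProbabilityMeasure (P.map (X m k)) := fun m k =>
    Measure.isProbabilityMeasure_map (hm m k)
  have hind : iIndepFun (fun q : Fin d × Fin N => X q.1 q.2) P := by
    refine hindep.precomp (g := fun q : Fin d × Fin N => (⟨q.2 + 1, hle q.2⟩, q.1)) ?_
    rintro ⟨m, k⟩ ⟨m', k'⟩ h
    simp only [Prod.mk.injEq, Subtype.mk.injEq, Nat.add_right_cancel_iff] at h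
    exact Prod.ext h.2 (Fin.ext h.1)
  let c : (Fin d → Fin N) → ℝ := fun i => if StrictMono i then b (fun s => i s + 1) else 0
  have hpoly : randomPolynomial ξ b N
      = (fun x : Fin d → Fin N → ℝ => ∑ i, c i * ∏ s, x s (i s)) ∘ fun ω m k => X m k ω := by
    ext ω
    simp only [randomPolynomial, Function.comp_apply, sum_indexSet_eq, c, X, ite_mul, zero_mul]
  have hmp : Measurable fun x : Fin d → Fin N → ℝ => ∑ i, c i * ∏ s, x s (i s) :=
    Finset.measurable_fun_sum _ fun i _ => (Finset.measurable_fun_prod _ fun s _ => by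
      fun_prop).const_mul _
  have hXm : AEMeasurable (fun ω m k => X m k ω) P :=
    aemeasurable_pi_iff.2 fun m => aemeasurable_pi_iff.2 fun k => hm m k
  rw [hpoly, ← eLpNorm_map_measure hmp.aestronglyMeasurable hXm, map_eq_pi_pi hm hind]
  refine (eLpNorm_multilinear_le hp _
    (fun m => ENNReal.ofReal (rosenthalConstant * (p / Real.log p)) * momentMax P n ξ m p)
    (fun m a => eLpNorm_linear_le hp _ (fun k => ?_) (hfin m).ne (fun k => ?_) a) c).trans_eq ?_
  · exact (integral_map (hm m k) (aestronglyMeasurable_id (α := ℝ))).trans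
      (hcent _ (hle k).1 (hle k).2 m)
  · refine (eLpNorm_map_measure (aestronglyMeasurable_id (α := ℝ)) (hm m k)).trans_le ?_
    exact le_iSup₂ (f := fun (i : ℕ) (_ : 1 ≤ i ∧ (i : ℕ∞) ≤ n) =>
      eLpNorm (ξ i m) (ENNReal.ofReal p) P) _ (hle k)
  · rw [Finset.prod_mul_distrib, Finset.prod_const, Finset.card_univ, Fintype.card_fin,
      ← ENNReal.ofReal_pow (by positivity), sum_indexSet_eq]
    simp only [c, ite_pow, ne_eq, OfNat.ofNat_ne_zero, not_false_eq_true, zero_pow]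

theorem sum_toFinset_indexSet_le {b : (Fin d → ℕ) → ℝ}
    (hb : HasSum (fun i : indexSet d n => b i ^ 2) 1) {N : ℕ} (hN : (N : ℕ∞) ≤ n) :
    ∑ i ∈ (indexSet_finite d N).toFinset, b i ^ 2 ≤ 1 := by
  have h := (hasSum_subtype_iff_indicator (f := fun i => b i ^ 2)).1 hb
  refine le_trans (Finset.sum_le_sum fun i hi => ?_)
    (sum_le_hasSum (indexSet_finite d N).toFinset
      (fun i _ => Set.indicator_nonneg (fun i _ => sq_nonneg (b i)) i) h)
  rw [Set.Finite.mem_toFinset] at hi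
  have hmem : i ∈ indexSet d n := ⟨hi.1, fun s => ⟨(hi.2 s).1, (hi.2 s).2.trans hN⟩⟩
  rw [Set.indicator_of_mem hmem]

end RandomPolynomial

theorem theorem3p1 {Ω : Type*} [MeasurableSpace Ω] (P : Measure Ω) [IsProbabilityMeasure P]
    (d : ℕ) (hd : 1 ≤ d) (n : ℕ∞) (p : ℝ) (hp : 2 ≤ p)
    (ξ : ℕ → Fin d → Ω → ℝ)
    (hmeas : ∀ i : ℕ, 1 ≤ i → (i : ℕ∞) ≤ n → ∀ m, AEMeasurable (ξ i m) P)
    (hcent : ∀ i : ℕ, 1 ≤ i → (i : ℕ∞) ≤ n → ∀ m, ∫ ω, ξ i m ω ∂P = 0)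
    (hindep : iIndepFun
      (fun k : {i : ℕ // 1 ≤ i ∧ (i : ℕ∞) ≤ n} × Fin d => ξ k.1 k.2) P)
    (hfin : ∀ m, momentMax P n ξ m p < ∞) :
    polynomialMomentSup P n ξ p ≤
      ENNReal.ofReal (kappa d * (p / Real.log p) ^ d) * ∏ m, momentMax P n ξ m p := by
  have hL : 0 < Real.log p := Real.log_pos (by linarith)
  refine iSup₂_le fun b hb => iSup₂_le fun Q hQ => ?_
  have hbound : ∀ N : ℕ, (N : ℕ∞) ≤ n → eLpNorm (randomPolynomial ξ b N) (ENNReal.ofReal p) P ≤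
      ENNReal.ofReal (kappa d * (p / Real.log p) ^ d) * ∏ m, momentMax P n ξ m p := by
    intro N hN
    refine (eLpNorm_randomPolynomial_le hp hmeas hcent hindep hfin b hN).trans ?_
    have h1 : ENNReal.ofReal √(∑ i ∈ (indexSet_finite d N).toFinset, b i ^ 2) ≤ 1 :=
      ENNReal.ofReal_le_one.2 (Real.sqrt_le_one.2 (sum_toFinset_indexSet_le hb hN))
    refine (mul_le_of_le_one_right' h1).trans ?_
    rw [mul_pow]
    gcongr
    exact rosenthalConstant_pow_le_kappa hd
  induction n using ENat.recTopCoe with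
  | top =>
    refine (Lp.eLpNorm_lim_le_liminf_eLpNorm
      (fun N => aestronglyMeasurable_randomPolynomial hmeas b (le_top : (N : ℕ∞) ≤ ⊤)) Q
      (hQ.2 rfl)).trans ?_
    exact liminf_le_of_frequently_le' (Frequently.of_forall fun N => hbound N le_top)
  | coe N =>
    rw [eLpNorm_congr_ae (hQ.1 N rfl)]
    exact hbound N le_rfl
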